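/- Let $G$ be a totally disconnected metrizable locally compact group, with identity $e$, and let $\tau\in\operatorname{Aut}(G)$ be a topological automorphism of $G$ (a group automorphism that is also a homeomorphism). Let $\langle\tau\rangle=\{\tau^n : n\in\mathbb Z\}$ be the subgroup of $\operatorname{Aut}(G)$ generated by $\tau$, and for $\gamma\in\operatorname{Aut}(G)$ let $C(\gamma)=\{x\in G : \lim_{n\to\infty}\gamma^n(x)=e\}$ be its contraction subgroup. Then the following four conditions are equivalent: (i) $\tau$ is distal, i.e. for every $x\in G\setminus\{e\}$ the identity $e$ does not belong to the closure of the orbit $\{\gamma(x) : \gamma\in\langle\tau\rangle\}$; (ii) $C(\tau)=C(\tau^{-1})=\{e\}$; (iii) for every compact open subgroup $U$ of $G$ there exists an integer $k\ge 0$ such that $\tau\bigl(\bigcap_{i=0}^k\tau^i(U)\bigr)=\bigcap_{i=0}^k\tau^i(U)$; (iv) $\langle\tau\rangle$ is equicontinuous (at $e$), i.e. for every neighbourhood $W$ of $e$ there is a neighbourhood $V$ of $e$ such that $\gamma(V)\subseteq W$ for all $\gamma\in\langle\tau\rangle$. -/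

import Mathlib

open Filter Topology

namespace TopAut

/-- The group `Aut(G)` of topological automorphisms of `G` is `G ≃ₜ* G`, with composition as
multiplication: `(σ * τ) x = σ (τ x)`. -/
instance instGroup {G : Type*} [Group G] [TopologicalSpace G] : Group (G ≃ₜ* G) where
  mul σ τ := τ.trans σ
  one := ContinuousMulEquiv.refl G
  inv τ := τ.symm
  mul_assoc _ _ _ := rfl
  one_mul _ := rfl
  mul_one _ := rfl
  inv_mul_cancel τ := τ.self_trans_symm

variable {G : Type*} [Group G] [TopologicalSpace G]

@[simp] theorem one_apply (x : G) : (1 : G ≃ₜ* G) x = x := rfl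

@[simp] theorem mul_apply (σ τ : G ≃ₜ* G) (x : G) : (σ * τ) x = σ (τ x) := rfl

@[simp] theorem inv_apply (τ : G ≃ₜ* G) (x : G) : τ⁻¹ x = τ.symm x := rfl

/-- The orbit `Γx = {γ(x) ; γ ∈ Γ}`. -/
def orbit (Γ : Subgroup (G ≃ₜ* G)) (x : G) : Set G := {y | ∃ γ ∈ Γ, γ x = y}

/-- `Γ` acts distally on `G`: for `x ≠ e`, the identity is not in the closure of the orbit `Γx`. -/
def ActsDistally (Γ : Subgroup (G ≃ₜ* G)) : Prop :=
  ∀ x : G, x ≠ 1 → (1 : G) ∉ closure (orbit Γ x)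

/-- A single automorphism is distal if the subgroup it generates acts distally. -/
def IsDistal (τ : G ≃ₜ* G) : Prop := ActsDistally (Subgroup.zpowers τ)

/-- The contraction subgroup `C(τ) = {x ; τ ^ n (x) → e as n → ∞}`. -/
def contraction [IsTopologicalGroup G] (τ : G ≃ₜ* G) : Subgroup G where
  carrier := {x | Tendsto (fun n : ℕ => (τ ^ n) x) atTop (𝓝 1)}
  one_mem' := by simp [tendsto_const_nhds]
  mul_mem' {x y} hx hy := by
    simpa using Filter.Tendsto.mul hx hy
  inv_mem' {x} hx := by
    simpa using Filter.Tendsto.inv hx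

/-- `Γ` is equicontinuous (at the identity), as a family of maps from `G` to `G` with the
uniform structure of the topological group `G`. The right and the left uniform structure
give the same notion at the identity, because every `γ ∈ Γ` fixes it. -/
def IsEquicontinuous [IsTopologicalGroup G] (Γ : Subgroup (G ≃ₜ* G)) : Prop :=
  letI : UniformSpace G := IsTopologicalGroup.rightUniformSpace G
  EquicontinuousAt (fun (γ : Γ) (x : G) => (γ : G ≃ₜ* G) x) 1

/-- `Γ` is equicontinuous if and only if the `Γ`-invariant neighbourhoods of the identity form a
neighbourhood base there. -/
theorem isEquicontinuous_iff_hasBasis [IsTopologicalGroup G] (Γ : Subgroup (G ≃ₜ* G)) :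
    IsEquicontinuous Γ ↔
      (𝓝 (1 : G)).HasBasis (fun V => V ∈ 𝓝 (1 : G) ∧ ∀ γ ∈ Γ, γ '' V = V) id := by
  have key : IsEquicontinuous Γ ↔ ∀ U ∈ 𝓝 (1 : G), ∀ᶠ x in 𝓝 (1 : G), ∀ γ : Γ, γ.1 x ∈ U := by
    let : UniformSpace G := IsTopologicalGroup.rightUniformSpace G
    have hb : (uniformity G).HasBasis (fun U => U ∈ 𝓝 (1 : G))
        (fun U => (fun p : G × G => p.2 * p.1⁻¹) ⁻¹' U) := (𝓝 (1 : G)).basis_sets.comap _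
    refine (hb.equicontinuousAt_iff_right).trans ?_
    simp
  rw [key]
  constructor
  · intro h
    refine ⟨fun U => ⟨fun hU => ?_, fun ⟨V, hV, hVU⟩ => mem_of_superset hV.1 hVU⟩⟩
    refine ⟨{x | ∀ γ : Γ, γ.1 x ∈ U}, ⟨h U hU, fun γ hγ => ?_⟩, fun x hx => hx 1⟩
    ext y
    constructor
    · rintro ⟨x, hx, rfl⟩ δ
      exact hx (δ * ⟨γ, hγ⟩)
    · intro hy
      refine ⟨γ⁻¹ y, fun δ => hy (δ * (⟨γ, hγ⟩ : Γ)⁻¹), by simp⟩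
  · intro h U hU
    obtain ⟨V, ⟨hV, hinv⟩, hVU⟩ := h.mem_iff.1 hU
    filter_upwards [hV] with x hx γ
    exact hVU ((hinv γ.1 γ.2).le ⟨x, hx, rfl⟩)

end TopAut

/-! ### Orbit-controlled subgroups and convergence modulo a subgroup. -/

namespace TopAut

variable {G : Type*} [Group G] [TopologicalSpace G]

/-! The hard implication is (ii) → (iii). Let `U` be compact open and `K = core τ U univ`, its
largest invariant subgroup. If the forward orbit of `x` stays in `U`, compactness makes it converge
to `K` (`ConvergesTo.inf_core`). Then `x K` meets `C(τ)`, so `x ∈ K` when `C(τ)` is trivial. With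
the same for `τ⁻¹`, the decreasing finite intersections in (iii) have intersection `K`, and
compactness makes one of them equal to `K`.

That `x K` meets `C(τ)` is proved by Zorn: take a minimal coset `y L` in `x K` with `L` compact
invariant and the orbit of `y` converging to `L`. For each compact open `V`, a shadowing argument
(`ConvergesTo.exists_eventually_mem`) moves `y` within `y L` so that its orbit ends in `V`;
minimality then forces `L ≤ V`. Hence the orbit of `y` tends to `e`.

The other implications are short: the intersection in (iii) is an invariant open subgroup inside
`U`, and an invariant neighbourhood of `e` missing `x` misses its whole orbit. -/

theorem zpow_add_apply (τ : G ≃ₜ* G) (i j : ℤ) (x : G) : (τ ^ (i + j)) x = (τ ^ i) ((τ ^ j) x) := by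
  rw [zpow_add, mul_apply]

theorem zpow_one_add_apply (τ : G ≃ₜ* G) (j : ℤ) (x : G) : (τ ^ (1 + j)) x = τ ((τ ^ j) x) := by
  rw [zpow_add_apply, zpow_one]

theorem zpow_neg_zpow_apply (τ : G ≃ₜ* G) (i : ℤ) (x : G) : (τ ^ (-i)) ((τ ^ i) x) = x := by
  rw [← zpow_add_apply, neg_add_cancel, zpow_zero, one_apply]

theorem zpow_zpow_neg_apply (τ : G ≃ₜ* G) (i : ℤ) (x : G) : (τ ^ i) ((τ ^ (-i)) x) = x := by
  rw [← zpow_add_apply, add_neg_cancel, zpow_zero, one_apply]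

theorem mem_image_zpow (τ : G ≃ₜ* G) (i : ℤ) (S : Set G) (x : G) :
    x ∈ (τ ^ i) '' S ↔ (τ ^ (-i)) x ∈ S := by
  constructor
  · rintro ⟨y, hy, rfl⟩
    rwa [zpow_neg_zpow_apply]
  · exact fun h => ⟨_, h, zpow_zpow_neg_apply τ i x⟩

/-- The elements of `G` whose images under `τ ^ i`, for `i ∈ I`, all lie in `V`. -/
def core (τ : G ≃ₜ* G) (V : Subgroup G) (I : Set ℤ) : Subgroup G where
  carrier := {x | ∀ i ∈ I, (τ ^ i) x ∈ V}
  one_mem' i _ := by simp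
  mul_mem' hx hy i hi := by simpa using V.mul_mem (hx i hi) (hy i hi)
  inv_mem' hx i hi := by simpa using hx i hi

theorem mem_core {τ : G ≃ₜ* G} {V : Subgroup G} {I : Set ℤ} {x : G} :
    x ∈ core τ V I ↔ ∀ i ∈ I, (τ ^ i) x ∈ V := Iff.rfl

theorem core_anti (τ : G ≃ₜ* G) (V : Subgroup G) {I J : Set ℤ} (h : I ⊆ J) :
    core τ V J ≤ core τ V I := fun _ hx i hi => hx i (h hi)

theorem core_le (τ : G ≃ₜ* G) (V : Subgroup G) {I : Set ℤ} (h : (0 : ℤ) ∈ I) : core τ V I ≤ V :=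
  fun x hx => by simpa using hx 0 h

theorem coe_core (τ : G ≃ₜ* G) (V : Subgroup G) (I : Set ℤ) :
    (core τ V I : Set G) = ⋂ i ∈ I, (τ ^ i) ⁻¹' (V : Set G) := by
  ext x; simp [mem_core]

theorem isClosed_core (τ : G ≃ₜ* G) {V : Subgroup G} (hV : IsClosed (V : Set G)) (I : Set ℤ) :
    IsClosed (core τ V I : Set G) := by
  rw [coe_core]
  exact isClosed_biInter fun i _ => hV.preimage (τ ^ i).continuous

theorem isOpen_core (τ : G ≃ₜ* G) {V : Subgroup G} (hV : IsOpen (V : Set G)) {I : Set ℤ}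
    (hI : I.Finite) : IsOpen (core τ V I : Set G) := by
  rw [coe_core]
  exact hI.isOpen_biInter fun i _ => hV.preimage (τ ^ i).continuous

/-- `L` is mapped into itself by all powers of `τ`. -/
def IsInvariant (τ : G ≃ₜ* G) (L : Subgroup G) : Prop := ∀ i : ℤ, ∀ x ∈ L, (τ ^ i) x ∈ L

theorem isInvariant_core_univ (τ : G ≃ₜ* G) (V : Subgroup G) :
    IsInvariant τ (core τ V Set.univ) := fun i x hx j _ => by
  rw [← zpow_add_apply]; exact hx _ trivial

theorem IsInvariant.inf {τ : G ≃ₜ* G} {L M : Subgroup G} (hL : IsInvariant τ L)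
    (hM : IsInvariant τ M) : IsInvariant τ (L ⊓ M) :=
  fun i x hx => ⟨hL i x hx.1, hM i x hx.2⟩

/-- The forward orbit of `y` converges to the subgroup `L`, modulo small open subgroups. -/
def ConvergesTo (τ : G ≃ₜ* G) (y : G) (L : Subgroup G) : Prop :=
  ∀ V : Subgroup G, IsOpen (V : Set G) →
    ∀ᶠ n : ℕ in atTop, ∃ v ∈ V, ∃ l ∈ L, (τ ^ (n : ℤ)) y = v * l

theorem ConvergesTo.mul_right {τ : G ≃ₜ* G} {y l : G} {L : Subgroup G} (h : ConvergesTo τ y L)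
    (hL : IsInvariant τ L) (hl : l ∈ L) : ConvergesTo τ (y * l) L := by
  intro V hV
  filter_upwards [h V hV] with n ⟨v, hv, m, hm, e⟩
  exact ⟨v, hv, m * (τ ^ (n : ℤ)) l, L.mul_mem hm (hL n l hl), by rw [map_mul, e, mul_assoc]⟩

variable [IsTopologicalGroup G]

theorem isOpen_mul_set {V : Subgroup G} (hV : IsOpen (V : Set G)) (L : Set G) :
    IsOpen {x | ∃ v ∈ V, ∃ l ∈ L, x = v * l} := by
  rw [isOpen_iff_mem_nhds]
  rintro _ ⟨v, hv, l, hl, rfl⟩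
  have : Tendsto (fun x => x * l⁻¹) (𝓝 (v * l)) (𝓝 v) := by
    simpa using (continuous_mul_const l⁻¹).tendsto (v * l)
  filter_upwards [this (hV.mem_nhds hv)] with x hx
  exact ⟨x * l⁻¹, hx, l, hl, by group⟩

theorem ConvergesTo.inf_core [T2Space G] {τ : G ≃ₜ* G} {z : G} {L U : Subgroup G}
    (hLc : IsClosed (L : Set G)) (hz : ConvergesTo τ z L)
    (hU : IsOpen (U : Set G)) (hUc : IsCompact (U : Set G))
    (hzU : ∀ᶠ n : ℕ in atTop, (τ ^ (n : ℤ)) z ∈ U) :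
    ConvergesTo τ z (L ⊓ core τ U Set.univ) := by
  intro V hV
  let E : ℕ → Subgroup G := fun m => L ⊓ core τ U (Set.Icc (-m : ℤ) m)
  have hanti : Antitone (fun m => (E m : Set G)) := fun m n hmn x hx =>
    ⟨hx.1, core_anti τ U (Set.Icc_subset_Icc (by simpa using hmn) (by simpa using hmn)) hx.2⟩
  have hE : ∀ m, IsCompact (E m : Set G) := fun m =>
    hUc.of_isClosed_subset (hLc.inter (isClosed_core τ (U.isClosed_of_isOpen hU) _))
      fun x hx => core_le τ U (by simp) hx.2
  obtain ⟨m, hm⟩ := exists_subset_nhds_of_isCompact hanti.directed_ge hE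
    (U := {x | ∃ v ∈ V, ∃ l ∈ L ⊓ core τ U Set.univ, x = v * l}) (by
      intro x hx
      rw [Set.mem_iInter] at hx
      refine (isOpen_mul_set hV _).mem_nhds ⟨1, V.one_mem, x, ⟨(hx 0).1, fun i _ => ?_⟩, by simp⟩
      exact (hx i.natAbs).2 i (by rw [Set.mem_Icc]; omega))
  obtain ⟨N, hN⟩ := eventually_atTop.1 hzU
  -- Past time `N + m` the orbit point has its `m` neighbours on both sides in `U`. Taking `v` in
  -- the same core passes this property to `l`.
  filter_upwards [hz (V ⊓ core τ U (Set.Icc (-m : ℤ) m))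
    (hV.inter (isOpen_core τ hU (Set.finite_Icc _ _))), eventually_ge_atTop (N + m)]
    with n ⟨v, hv, l, hl, e⟩ hn
  have hzn : (τ ^ (n : ℤ)) z ∈ core τ U (Set.Icc (-m : ℤ) m) := fun i hi => by
    rw [Set.mem_Icc] at hi
    rw [← zpow_add_apply]
    obtain ⟨j, hj⟩ := Int.eq_ofNat_of_zero_le (a := i + n) (by omega)
    rw [hj]
    exact hN j (by omega)
  have hlE : l ∈ E m := ⟨hl, (Subgroup.mul_mem_cancel_left _ hv.2).1 (e ▸ hzn)⟩
  obtain ⟨v', hv', l', hl', rfl⟩ := hm hlE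
  exact ⟨v * v', V.mul_mem hv.1 hv', l', hl', by rw [e, mul_assoc]⟩

/-- Van Dantzig's theorem: the stabilizer of a compact open set `C ∋ e` under left translation lies
in `C` and is open by a tube argument. -/
theorem exists_isCompact_isOpen_subgroup [LocallyCompactSpace G] [TotallyDisconnectedSpace G]
    [T2Space G] {W : Set G} (hW : W ∈ 𝓝 (1 : G)) :
    ∃ U : Subgroup G, IsOpen (U : Set G) ∧ IsCompact (U : Set G) ∧ (U : Set G) ⊆ W := by
  obtain ⟨K, hK, hKW, hKc⟩ := local_compact_nhds hW
  obtain ⟨C, hC, h1, hCK⟩ := (loc_compact_Haus_tot_disc_of_zero_dim (H := G)).mem_nhds_iff.1 hK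
  have hCc : IsCompact C := hKc.of_isClosed_subset hC.isClosed hCK
  let H : Subgroup G := {
    carrier := {g | ∀ x ∈ C, g * x ∈ C ∧ g⁻¹ * x ∈ C}
    one_mem' := fun x hx => by simpa using hx
    mul_mem' := fun {a b} ha hb x hx => by
      rw [mul_inv_rev, mul_assoc, mul_assoc]
      exact ⟨(ha _ (hb x hx).1).1, (hb _ (ha x hx).2).2⟩
    inv_mem' := fun {a} ha x hx => by
      rw [inv_inv]
      exact (ha x hx).symm }
  have hHC : (H : Set G) ⊆ C := fun g hg => by simpa using (hg 1 h1).1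
  have hHo : IsOpen (H : Set G) := by
    refine H.isOpen_of_mem_nhds (g := 1) ?_
    refine hCc.eventually_forall_of_forall_eventually fun x hx => ?_
    have c1 : ContinuousAt (fun p : G × G => p.1 * p.2) (1, x) := by fun_prop
    have c2 : ContinuousAt (fun p : G × G => p.1⁻¹ * p.2) (1, x) := by fun_prop
    have hC' : C ∈ 𝓝 x := hC.isOpen.mem_nhds hx
    exact (c1.eventually_mem (by simpa using hC')).and (c2.eventually_mem (by simpa using hC'))
  exact ⟨H, hHo, hCc.of_isClosed_subset (H.isClosed_of_isOpen hHo) hHC, hHC.trans (hCK.trans hKW)⟩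

end TopAut

/-! ### Shadowing of pseudo-orbits. -/

namespace TopAut

variable {G : Type*} [Group G] [TopologicalSpace G] 
/-- The pseudo-orbit of `u` along `τ` with errors `e`. -/
def pseudoOrbit (τ : G ≃ₜ* G) (e : ℕ → G) (u : G) : ℕ → G
  | 0 => u
  | n + 1 => e n * τ (pseudoOrbit τ e u n)

/-- Pseudo-orbits with the same errors differ by a true orbit, on the right. -/
theorem pseudoOrbit_mul (τ : G ≃ₜ* G) (e : ℕ → G) (u g : G) (n : ℕ) :
    pseudoOrbit τ e (u * g) n = pseudoOrbit τ e u n * (τ ^ (n : ℤ)) g := by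
  induction n with
  | zero => simp [pseudoOrbit]
  | succ n ih =>
    rw [pseudoOrbit, ih, pseudoOrbit, map_mul, Nat.cast_succ, add_comm (n : ℤ),
      zpow_one_add_apply, mul_assoc]

variable [IsTopologicalGroup G]

theorem continuous_pseudoOrbit (τ : G ≃ₜ* G) (e : ℕ → G) (n : ℕ) :
    Continuous fun u => pseudoOrbit τ e u n := by
  have : (fun u => pseudoOrbit τ e u n) = fun u => pseudoOrbit τ e 1 n * (τ ^ (n : ℤ)) u := by
    ext u
    rw [← pseudoOrbit_mul, one_mul]
  rw [this]
  exact continuous_const.mul (τ ^ (n : ℤ)).continuous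

variable [T2Space G]

/-- A compact invariant subgroup, cut down by finitely many translates of an open subgroup, becomes
"tidy above". -/
theorem exists_forall_apply_mem_mul (τ : G ≃ₜ* G) {L V : Subgroup G}
    (hLc : IsCompact (L : Set G)) (hV : IsOpen (V : Set G)) :
    ∃ k : ℕ, ∀ t ∈ L ⊓ core τ V (Set.Icc (-k : ℤ) 0), ∀ n : ℕ,
      ∃ s ∈ L ⊓ core τ V (Set.Icc (-n : ℤ) 0), ∃ v ∈ V, τ t = v * τ s := by
  let W : ℕ → Subgroup G := fun n => L ⊓ core τ V (Set.Icc (-n : ℤ) 0)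
  have hanti : Antitone (fun m => (W m : Set G)) := fun m n hmn x hx =>
    ⟨hx.1, core_anti τ V (Set.Icc_subset_Icc_left (by simpa using hmn)) hx.2⟩
  have hW : ∀ m, IsCompact (W m : Set G) := fun m =>
    hLc.inter_right (isClosed_core τ (V.isClosed_of_isOpen hV) _)
  -- A point `x` of every `W n` serves as `s` for all `n` at once, and for all `t` near `x`.
  obtain ⟨k, hk⟩ := exists_subset_nhds_of_isCompact hanti.directed_ge hW
    (U := {t | ∀ n, ∃ s ∈ W n, ∃ v ∈ V, τ t = v * τ s}) (by
      intro x hx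
      rw [Set.mem_iInter] at hx
      have ho : IsOpen {t | ∃ v ∈ V, ∃ l ∈ ({τ x} : Set G), τ t = v * l} :=
        (isOpen_mul_set hV {τ x}).preimage τ.continuous
      filter_upwards [ho.mem_nhds ⟨1, V.one_mem, τ x, rfl, by simp⟩]
      rintro t ⟨v, hv, _, rfl, e⟩ n
      exact ⟨x, hx n, v, hv, e⟩)
  exact ⟨k, fun t ht => hk ht⟩

/-- Errors in the subgroup can be absorbed by correcting the starting point: any finite time is
reached by induction, infinite time by compactness. -/
theorem exists_forall_pseudoOrbit_mem {τ : G ≃ₜ* G} {L V : Subgroup G} (hLc : IsCompact (L : Set G))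
    (hL : IsInvariant τ L) (hV : IsOpen (V : Set G)) {k : ℕ}
    (hk : ∀ t ∈ L ⊓ core τ V (Set.Icc (-k : ℤ) 0), ∀ n : ℕ,
      ∃ s ∈ L ⊓ core τ V (Set.Icc (-n : ℤ) 0), ∃ v ∈ V, τ t = v * τ s)
    {e : ℕ → G} (he : ∀ n, e n ∈ L ⊓ core τ V (Set.Icc (-k : ℤ) 0)) :
    ∃ u, ∀ n, pseudoOrbit τ e u n ∈ L ⊓ core τ V (Set.Icc (-k : ℤ) 0) := by
  set W : Subgroup G := L ⊓ core τ V (Set.Icc (-k : ℤ) 0) with hWdef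
  have hWc : IsCompact (W : Set G) := hLc.inter_right (isClosed_core τ (V.isClosed_of_isOpen hV) _)
  have hfin : ∀ n : ℕ, ∃ u, ∀ i ≤ n, pseudoOrbit τ e u i ∈ W := by
    intro n
    induction n with
    | zero => exact ⟨1, fun i hi => by simp [Nat.le_zero.1 hi, pseudoOrbit]⟩
    | succ n ih =>
      obtain ⟨u, hu⟩ := ih
      have ht := hu n le_rfl
      -- Dividing by `s` at time `n` turns the next point into `e n * v`. The length `k + n` keeps
      -- the corrections at all earlier times inside `W`.
      obtain ⟨s, hs, v, hv, hvs⟩ := hk _ ht (k + n)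
      have hsW : ∀ i : ℕ, i ≤ n → (τ ^ (-i : ℤ)) s ∈ W := fun i hi => ⟨hL _ _ hs.1, fun j hj => by
        rw [Set.mem_Icc] at hj
        rw [← zpow_add_apply]
        exact hs.2 _ (by rw [Set.mem_Icc]; push_cast; omega)⟩
      have hvW : v ∈ W := by
        have hts : pseudoOrbit τ e u n * s⁻¹ ∈ W :=
          W.mul_mem ht (W.inv_mem (by simpa using hsW 0 (Nat.zero_le _)))
        have hv' : v = τ (pseudoOrbit τ e u n * s⁻¹) := by
          rw [map_mul, map_inv, hvs, mul_inv_cancel_right]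
        refine ⟨by simpa [hv'] using hL 1 _ hts.1, fun i hi => ?_⟩
        rw [Set.mem_Icc] at hi
        rcases eq_or_lt_of_le hi.2 with rfl | h0
        · simpa using hv
        · have := hts.2 (i + 1) (by rw [Set.mem_Icc]; omega)
          rwa [zpow_add_apply, zpow_one, ← hv'] at this
      refine ⟨u * (τ ^ (-n : ℤ)) s⁻¹, fun i hi => ?_⟩
      rw [pseudoOrbit_mul, ← zpow_add_apply]
      rcases Nat.lt_or_ge n i with h | h
      · obtain rfl : i = n + 1 := by omega
        rw [pseudoOrbit, hvs, show ((n + 1 : ℕ) : ℤ) + -n = 1 by push_cast; ring, zpow_one,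
          map_inv, mul_assoc, mul_inv_cancel_right]
        exact W.mul_mem (he n) hvW
      · refine W.mul_mem (hu i h) ?_
        rw [map_inv, show (i : ℤ) + -n = -((n - i : ℕ) : ℤ) by omega]
        exact W.inv_mem (hsW _ (Nat.sub_le _ _))
  let B : ℕ → Set G := fun n => {u | ∀ i ≤ n, pseudoOrbit τ e u i ∈ W}
  have hBcl : ∀ n, IsClosed (B n) := fun n => by
    have : B n = ⋂ i, ⋂ (_ : i ≤ n), (fun u => pseudoOrbit τ e u i) ⁻¹' (W : Set G) := by
      ext; simp [B]
    rw [this]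
    exact isClosed_iInter fun i => isClosed_iInter fun _ =>
      hWc.isClosed.preimage (continuous_pseudoOrbit τ e i)
  obtain ⟨u, hu⟩ := IsCompact.nonempty_iInter_of_sequence_nonempty_isCompact_isClosed B
    (fun n u hu i hi => hu i (hi.trans n.le_succ)) hfin
    (hWc.of_isClosed_subset (hBcl 0) fun u hu => hu 0 le_rfl) hBcl
  exact ⟨u, fun n => Set.mem_iInter.1 hu n n le_rfl⟩

/-- If the orbit of `y` converges to the compact invariant subgroup `L`, then for every open
subgroup `V` the orbit of some element of `y L` is eventually in `V`. -/
theorem ConvergesTo.exists_eventually_mem {τ : G ≃ₜ* G} {y : G} {L V : Subgroup G}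
    (hy : ConvergesTo τ y L) (hLc : IsCompact (L : Set G)) (hL : IsInvariant τ L)
    (hV : IsOpen (V : Set G)) : ∃ h ∈ L, ∀ᶠ n : ℕ in atTop, (τ ^ (n : ℤ)) (y * h) ∈ V := by
  obtain ⟨k, hk⟩ := exists_forall_apply_mem_mul τ hLc hV
  set V' : Subgroup G := core τ V (Set.Icc (-k : ℤ) 0) with hV'
  have hVo : IsOpen ((V' ⊓ V'.comap (τ : G →* G) : Subgroup G) : Set G) :=
    have := isOpen_core τ hV (Set.finite_Icc (-k : ℤ) 0)
    this.inter (this.preimage τ.continuous)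
  obtain ⟨N, hN⟩ := eventually_atTop.1 (hy _ hVo)
  choose! v hv l hl hvl using hN
  have hstep : ∀ n, (τ ^ ((n + 1 : ℕ) : ℤ)) y = τ ((τ ^ (n : ℤ)) y) := fun n => by
    rw [Nat.cast_succ, add_comm, zpow_one_add_apply]
  have herr : ∀ n, N ≤ n → l (n + 1) = (v (n + 1))⁻¹ * τ (v n) * τ (l n) := fun n hn => by
    have := hstep n
    rw [hvl n hn, hvl (n + 1) (by omega), map_mul] at this
    rw [mul_assoc, ← this, inv_mul_cancel_left]
  have he : ∀ n, (v (N + n + 1))⁻¹ * τ (v (N + n)) ∈ L ⊓ V' := fun n => by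
    refine ⟨?_, V'.mul_mem (V'.inv_mem (hv _ (by omega)).1) (hv (N + n) (by omega)).2⟩
    have h1 : τ (l (N + n)) ∈ L := by simpa using hL 1 _ (hl (N + n) (by omega))
    exact (Subgroup.mul_mem_cancel_right L h1).1 (herr (N + n) (by omega) ▸ hl _ (by omega))
  obtain ⟨u, hu⟩ := exists_forall_pseudoOrbit_mem hLc hL hV hk he
  have huL : u ∈ L := (hu 0).1
  -- The `l n` form a pseudo-orbit from time `N`; this factor changes its starting value from `l N`
  -- to `u`.
  refine ⟨(τ ^ (-N : ℤ)) ((l N)⁻¹ * u), hL _ _ (L.mul_mem (L.inv_mem (hl N le_rfl)) huL), ?_⟩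
  have key : ∀ n : ℕ, l (N + n) * (τ ^ ((N + n : ℕ) : ℤ)) ((τ ^ (-N : ℤ)) ((l N)⁻¹ * u)) =
      pseudoOrbit τ (fun n => (v (N + n + 1))⁻¹ * τ (v (N + n))) u n := by
    intro n
    rw [← zpow_add_apply, show ((N + n : ℕ) : ℤ) + -N = n by push_cast; ring]
    induction n with
    | zero => simp [pseudoOrbit]
    | succ n ih =>
      rw [pseudoOrbit, ← ih, ← add_assoc, herr (N + n) (by omega), Nat.cast_succ, add_comm (n : ℤ),
        zpow_one_add_apply, map_mul]
      simp only [mul_assoc, map_mul]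
  refine eventually_atTop.2 ⟨N, fun n hn => ?_⟩
  obtain ⟨m, rfl⟩ := Nat.exists_eq_add_of_le hn
  rw [map_mul, hvl _ hn, mul_assoc, key]
  exact core_le τ V (by simp) (V'.mul_mem (hv _ hn).1 (hu m).2)

end TopAut

/-! ### Contraction subgroups and the equivalences. -/

namespace TopAut

variable {G : Type*} [Group G] [TopologicalSpace G]

theorem biInter_image_pow (τ : G ≃ₜ* G) (U : Subgroup G) (k : ℕ) :
    (⋂ i ≤ k, (τ ^ i) '' (U : Set G)) = core τ U (Set.Icc (-k : ℤ) 0) := by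
  ext x
  simp only [Set.mem_iInter, SetLike.mem_coe, mem_core, Set.mem_Icc]
  constructor
  · intro h i hi
    obtain ⟨j, rfl⟩ : ∃ j : ℕ, i = -j := ⟨i.natAbs, by omega⟩
    have := h j (by omega)
    rwa [← zpow_natCast, mem_image_zpow] at this
  · intro h i hi
    rw [← zpow_natCast, mem_image_zpow]
    exact h _ (by omega)

theorem IsInvariant.image_zpow_eq {τ : G ≃ₜ* G} {L : Subgroup G} (hL : IsInvariant τ L) (i : ℤ) :
    (τ ^ i) '' (L : Set G) = L := by
  ext x
  rw [mem_image_zpow]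
  refine ⟨fun h => ?_, hL _ x⟩
  rw [← zpow_zpow_neg_apply τ i x]
  exact hL i _ h

theorem image_zpow_eq_of_image_eq {τ : G ≃ₜ* G} {S : Set G} (h : τ '' S = S) (i : ℤ) :
    (τ ^ i) '' S = S := by
  have hn : ∀ n : ℕ, (τ ^ (n : ℤ)) '' S = S := fun n => by
    induction n with
    | zero => simp [Set.image]
    | succ n ih =>
      conv_rhs => rw [← h, ← ih, Set.image_image]
      rw [Nat.cast_succ, add_comm]
      exact Set.image_congr fun x _ => zpow_one_add_apply τ n x
  obtain ⟨n, rfl | rfl⟩ := i.eq_nat_or_neg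
  · exact hn n
  · conv_lhs => rw [← hn n, Set.image_image]
    simp only [zpow_neg_zpow_apply, Set.image_id']

variable [IsTopologicalGroup G]

theorem IsDistal.contraction_eq_bot {τ : G ≃ₜ* G} (h : IsDistal τ) {γ : G ≃ₜ* G}
    (hγ : γ ∈ Subgroup.zpowers τ) : contraction γ = ⊥ := by
  refine (Subgroup.eq_bot_iff_forall _).2 fun x hx => ?_
  by_contra hne
  exact h x hne (mem_closure_of_tendsto (show Tendsto _ _ _ from hx) (Eventually.of_forall fun n =>
    ⟨γ ^ n, Subgroup.pow_mem _ hγ n, rfl⟩))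

variable [T2Space G]

open Pointwise in
/-- If the orbit of `x` converges to the compact invariant subgroup `K`, then the coset `x K`
contains an element of the contraction subgroup. -/
theorem ConvergesTo.exists_mul_mem_contraction [LocallyCompactSpace G] [TotallyDisconnectedSpace G]
    {τ : G ≃ₜ* G} {x : G} {K : Subgroup G} (hx : ConvergesTo τ x K) (hKc : IsCompact (K : Set G))
    (hK : IsInvariant τ K) : ∃ h ∈ K, x * h ∈ contraction τ := by
  let S : Set (Set G) := {A | A ⊆ x • (K : Set G) ∧ ∃ (L : Subgroup G) (y : G),
    IsCompact (L : Set G) ∧ IsInvariant τ L ∧ ConvergesTo τ y L ∧ A = y • (L : Set G)}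
  have hxS : x • (K : Set G) ∈ S := ⟨subset_rfl, K, x, hKc, hK, hx, rfl⟩
  have hchain : ∀ c ⊆ S, IsChain (· ⊆ ·) c → c.Nonempty → ∃ lb ∈ S, ∀ s ∈ c, lb ⊆ s := by
    intro c hcS hc hne
    have : Nonempty c := hne.to_subtype
    have hcpt : ∀ A ∈ c, IsCompact A := fun A hA => by
      obtain ⟨-, L, y, hLc, -, -, rfl⟩ := hcS hA
      exact hLc.smul y
    have hdir : DirectedOn (· ⊇ ·) c := fun A hA B hB => by
      rcases hc.total hA hB with h | h
      · exact ⟨A, hA, subset_rfl, h⟩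
      · exact ⟨B, hB, h, subset_rfl⟩
    obtain ⟨y, hy⟩ := IsCompact.nonempty_sInter_of_directed_nonempty_isCompact_isClosed hdir
      (fun A hA => by
        obtain ⟨-, L, y, -, -, -, rfl⟩ := hcS hA
        exact ⟨y, by simpa using Set.smul_mem_smul_set (a := y) L.one_mem⟩)
      hcpt (fun A hA => (hcpt A hA).isClosed)
    have hL : ∀ A : c, ∃ L : Subgroup G, IsCompact (L : Set G) ∧ IsInvariant τ L ∧
        ConvergesTo τ y L ∧ (A : Set G) = y • (L : Set G) := by
      rintro ⟨A, hA⟩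
      obtain ⟨-, L, z, hLc, hLi, hz, rfl⟩ := hcS hA
      obtain ⟨l, hl, rfl⟩ := Set.mem_sInter.1 hy _ hA
      refine ⟨L, hLc, hLi, hz.mul_right hLi hl, ?_⟩
      change z • (L : Set G) = (z * l) • (L : Set G)
      rw [mul_smul, smul_coe_set hl]
    choose L hLc hLi hLy hAL using hL
    have hsub : ∀ A B : c, (A : Set G) ⊆ B → L A ≤ L B := fun A B h => by
      rw [hAL A, hAL B] at h
      exact Set.smul_set_subset_smul_set_iff.1 h
    have hdirL : Directed (· ⊇ ·) fun A : c => (L A : Set G) := fun A B => by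
      obtain ⟨C, hC, hCA, hCB⟩ := hdir A A.2 B B.2
      exact ⟨⟨C, hC⟩, hsub ⟨C, hC⟩ A hCA, hsub ⟨C, hC⟩ B hCB⟩
    have hle : ∀ A : c, y • ((⨅ A, L A : Subgroup G) : Set G) ⊆ A := fun A => by
      rw [hAL A]
      exact Set.smul_set_mono (iInf_le L A)
    obtain ⟨A₀⟩ := this
    refine ⟨y • ((⨅ A, L A : Subgroup G) : Set G), ⟨(hle A₀).trans (hcS A₀.2).1, _, y, ?_, ?_, ?_,
      rfl⟩, fun A hA => hle ⟨A, hA⟩⟩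
    · rw [Subgroup.coe_iInf]
      exact (hLc A₀).of_isClosed_subset (isClosed_iInter fun A => (hLc A).isClosed)
        (Set.iInter_subset _ A₀)
    · intro i z hz
      rw [Subgroup.mem_iInf] at hz ⊢
      exact fun A => hLi A i z (hz A)
    · intro V hV
      have : Nonempty c := ⟨A₀⟩
      obtain ⟨A, hA⟩ := exists_subset_nhds_of_isCompact hdirL hLc
        (U := {x | ∃ v ∈ V, ∃ l ∈ (⨅ A, L A : Subgroup G), x = v * l}) (fun z hz =>
          (isOpen_mul_set hV _).mem_nhds
            ⟨1, V.one_mem, z, by simpa using hz, by simp⟩)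
      filter_upwards [hLy A V hV] with n ⟨v, hv, l, hl, e⟩
      obtain ⟨v', hv', l', hl', rfl⟩ := hA hl
      exact ⟨v * v', V.mul_mem hv hv', l', hl', by rw [e, mul_assoc]⟩
  obtain ⟨A, -, hA⟩ := zorn_superset_nonempty S hchain _ hxS
  obtain ⟨hAx, L, y, hLc, hLi, hy, rfl⟩ := hA.prop
  -- Otherwise the coset of `L ⊓ core τ V univ` through `y * h` would be strictly smaller.
  have hLV : ∀ V : Subgroup G, IsOpen (V : Set G) → IsCompact (V : Set G) → L ≤ V := by
    intro V hV hVc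
    obtain ⟨h, hh, hev⟩ := hy.exists_eventually_mem hLc hLi hV
    have hconv := (hy.mul_right hLi hh).inf_core hLc.isClosed hV hVc hev
    set L' := L ⊓ core τ V Set.univ
    have hsub : (y * h) • (L' : Set G) ⊆ y • (L : Set G) := by
      rw [mul_smul]
      refine Set.smul_set_mono ?_
      rw [← smul_coe_set hh]
      exact Set.smul_set_mono fun z hz => hz.1
    have hmem : (y * h) • (L' : Set G) ∈ S :=
      ⟨hsub.trans hAx, L', y * h, hLc.inter_right (isClosed_core τ hVc.isClosed _),
        hLi.inf (isInvariant_core_univ τ V), hconv, rfl⟩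
    have hle : y • (L : Set G) ⊆ (y * h) • (L' : Set G) := hA.le_of_le hmem hsub
    rw [mul_smul, Set.smul_set_subset_smul_set_iff, ← smul_coe_set hh,
      Set.smul_set_subset_smul_set_iff] at hle
    exact fun z hz => core_le τ V (Set.mem_univ _) (hle hz).2
  obtain ⟨h, hh, rfl⟩ := hAx (by simpa using Set.smul_mem_smul_set (a := y) L.one_mem)
  refine ⟨h, hh, ?_⟩
  change ConvergesTo τ (x * h) L at hy
  change Tendsto (fun n : ℕ => (τ ^ n) (x * h)) atTop (𝓝 1)
  intro W hW
  obtain ⟨V, hV, hVc, hVW⟩ := exists_isCompact_isOpen_subgroup hW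
  refine mem_map.2 ?_
  filter_upwards [hy V hV] with n ⟨v, hv, l, hl, e⟩
  refine hVW ?_
  rw [zpow_natCast] at e
  simp only [e]
  exact V.mul_mem hv (hLV V hV hVc hl)

/-- If the contraction subgroup is trivial, elements whose forward orbit stays in a compact open
subgroup have their whole orbit in it. -/
theorem mem_core_univ_of_forward [LocallyCompactSpace G] [TotallyDisconnectedSpace G]
    {τ : G ≃ₜ* G} (hτ : contraction τ = ⊥) {U : Subgroup G} (hU : IsOpen (U : Set G))
    (hUc : IsCompact (U : Set G)) {x : G} (hx : x ∈ core τ U (Set.Ici 0)) :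
    x ∈ core τ U Set.univ := by
  have htop : ConvergesTo τ x ⊤ := fun V hV =>
    Eventually.of_forall fun n => ⟨1, V.one_mem, (τ ^ (n : ℤ)) x, trivial, by simp⟩
  have hconv := htop.inf_core isClosed_univ hU hUc
    (Eventually.of_forall fun n => hx n (by simp))
  rw [top_inf_eq] at hconv
  obtain ⟨h, hh, hc⟩ := hconv.exists_mul_mem_contraction
    (hUc.of_isClosed_subset (isClosed_core τ hUc.isClosed _) (core_le τ U (Set.mem_univ _)))
    (isInvariant_core_univ τ U)
  rw [hτ, Subgroup.mem_bot] at hc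
  rw [eq_inv_of_mul_eq_one_left hc]
  exact Subgroup.inv_mem _ hh

theorem exists_core_eq_core_univ [LocallyCompactSpace G] [TotallyDisconnectedSpace G]
    {τ : G ≃ₜ* G} (h₁ : contraction τ = ⊥) (h₂ : contraction τ⁻¹ = ⊥) {U : Subgroup G}
    (hU : IsOpen (U : Set G)) (hUc : IsCompact (U : Set G)) :
    ∃ k : ℕ, core τ U (Set.Icc (-k : ℤ) 0) = core τ U Set.univ := by
  have hanti : Antitone (fun k : ℕ => (core τ U (Set.Icc (-k : ℤ) 0) : Set G)) :=
    fun m n hmn => core_anti τ U (Set.Icc_subset_Icc_left (by simpa using hmn))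
  -- Points of the full intersection have backward orbit in `U`, hence also forward orbit, by
  -- triviality of `C(τ⁻¹)`. So some finite stage is already sent into `U`, and therefore into
  -- itself, by `τ`.
  obtain ⟨k, hk⟩ := exists_subset_nhds_of_isCompact (U := τ ⁻¹' (U : Set G)) hanti.directed_ge
    (fun k => hUc.of_isClosed_subset (isClosed_core τ hUc.isClosed _) (core_le τ U (by simp))) (by
      intro x hx
      refine (hU.preimage τ.continuous).mem_nhds ?_
      rw [Set.mem_iInter] at hx
      have hx' : x ∈ core τ⁻¹ U Set.univ := by
        refine mem_core_univ_of_forward h₂ hU hUc fun i hi => ?_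
        rw [Set.mem_Ici] at hi
        rw [inv_zpow']
        exact hx i.natAbs _ (by rw [Set.mem_Icc]; omega)
      have := hx' (-1) trivial
      rwa [inv_zpow', neg_neg, zpow_one] at this)
  refine ⟨k, le_antisymm (fun x hx => ?_) (core_anti τ U (Set.subset_univ _))⟩
  have hstep : ∀ y ∈ core τ U (Set.Icc (-k : ℤ) 0), τ y ∈ core τ U (Set.Icc (-k : ℤ) 0) := by
    intro y hy i hi
    rw [Set.mem_Icc] at hi
    rcases eq_or_lt_of_le hi.2 with rfl | h0
    · simpa using hk hy
    · have := hy (i + 1) (by rw [Set.mem_Icc]; omega)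
      rwa [zpow_add_apply, zpow_one] at this
  have hiter : ∀ n : ℕ, (τ ^ (n : ℤ)) x ∈ core τ U (Set.Icc (-k : ℤ) 0) := by
    intro n
    induction n with
    | zero => simpa using hx
    | succ n ih =>
      rw [Nat.cast_succ, add_comm, zpow_one_add_apply]
      exact hstep _ ih
  refine mem_core_univ_of_forward h₁ hU hUc fun i hi => ?_
  obtain ⟨n, rfl⟩ := Int.eq_ofNat_of_zero_le hi
  exact core_le τ U (by simp) (hiter n)

end TopAut

open TopAut in
theorem proposition2p1 {G : Type*} [Group G] [TopologicalSpace G] [IsTopologicalGroup G]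
    [LocallyCompactSpace G] [TotallyDisconnectedSpace G] [TopologicalSpace.MetrizableSpace G]
    (τ : G ≃ₜ* G) :
    List.TFAE [
      TopAut.IsDistal τ,
      TopAut.contraction τ = ⊥ ∧ TopAut.contraction τ⁻¹ = ⊥,
      ∀ U : Subgroup G, IsOpen (U : Set G) → IsCompact (U : Set G) →
        ∃ k : ℕ, τ '' (⋂ i ≤ k, (τ ^ i) '' (U : Set G)) = ⋂ i ≤ k, (τ ^ i) '' (U : Set G),
      TopAut.IsEquicontinuous (Subgroup.zpowers τ)] := by
  tfae_have 1 → 2 := fun h =>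
    ⟨h.contraction_eq_bot (Subgroup.mem_zpowers τ),
      h.contraction_eq_bot (Subgroup.inv_mem _ (Subgroup.mem_zpowers τ))⟩
  tfae_have 2 → 3 := by
    rintro ⟨h₁, h₂⟩ U hU hUc
    obtain ⟨k, hk⟩ := exists_core_eq_core_univ h₁ h₂ hU hUc
    refine ⟨k, ?_⟩
    rw [biInter_image_pow, hk]
    simpa using (isInvariant_core_univ τ U).image_zpow_eq 1
  tfae_have 3 → 4 := by
    intro h
    rw [isEquicontinuous_iff_hasBasis]
    refine ⟨fun W => ⟨fun hW => ?_, fun ⟨V, hV, hVW⟩ => mem_of_superset hV.1 hVW⟩⟩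
    obtain ⟨U, hU, hUc, hUW⟩ := exists_isCompact_isOpen_subgroup hW
    obtain ⟨k, hk⟩ := h U hU hUc
    rw [biInter_image_pow] at hk
    refine ⟨core τ U (Set.Icc (-k : ℤ) 0), ⟨(isOpen_core τ hU (Set.finite_Icc _ _)).mem_nhds
      (Subgroup.one_mem _), fun γ hγ => ?_⟩,
      fun x hx => hUW (core_le τ U (by simp) hx)⟩
    obtain ⟨i, rfl⟩ := hγ
    exact image_zpow_eq_of_image_eq hk i
  tfae_have 4 → 1 := by
    intro h x hx hcl
    rw [isEquicontinuous_iff_hasBasis] at h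
    obtain ⟨V, ⟨hV, hinv⟩, hVx⟩ := h.mem_iff.1 (isOpen_ne.mem_nhds hx.symm : {y | y ≠ x} ∈ 𝓝 1)
    obtain ⟨_, hyV, γ, hγ, rfl⟩ := mem_closure_iff_nhds.1 hcl V hV
    have : γ⁻¹ (γ x) ∈ V := (hinv γ⁻¹ (Subgroup.inv_mem _ hγ)).le ⟨_, hyV, rfl⟩
    exact hVx this (by simp)
  tfae_finish
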